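/- **Conventions.** A *pseudospace* is a set $X$ with a relation $\mathscr U\to x$ between ultrafilters on $X$ and points of $X$ such that every principal ultrafilter $\dot x$ converges to $x$; a filter converges to $x$ if all finer ultrafilters do. A map $f$ is *continuous* if $\mathscr U\to x$ implies $f_*\mathscr U\to f(x)$. This gives the category $\mathsf{PsTop}$; topological spaces, with convergence of ultrafilters, form a full subcategory $\mathsf{Top}$. The function space $Y^X$ is the set of continuous maps $X\to Y$ with $\mathscr F\to f$ iff $\mathrm{ev}_*(\mathscr F\times\mathscr G)\to f(x)$ for all filters $\mathscr G$ and points $x$ with $\mathscr G\to x$. A pseudospace is an *epispace* if it carries the initial structure with respect to some collection of maps $X\to Z_j^{Y_j}$ with $Y_j,Z_j$ topological spaces; $\mathsf{EpiTop}\subset\mathsf{PsTop}$ is the full subcategory of epispaces. A subscript $*$ denotes pointed objects and based maps. $\mathsf{PsTopGrp}$ (resp. $\mathsf{EpiTopGrp}$) is the category of groups with a pseudotopology (resp. epitopology) making multiplication and inversion continuous, with continuous homomorphisms; $\mathsf{QTopGrp}$ is the category of groups with a topology making inversion and all left and right translations continuous, with continuous homomorphisms. For a pointed pseudospace (resp.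 epispace) $(X,x_0)$ let $\Omega(X,x_0)$ be the subspace of $X^{[0,1]}$ of loops at $x_0$, and let $\pi_1^{\mathrm{ps}}(X,x_0)$ (resp. $\pi_1^{\mathrm{epi}}(X,x_0)$) be the group of path components of $\Omega(X,x_0)$, with the operation induced by concatenation, and the quotient structure of $\Omega(X,x_0)$ in $\mathsf{PsTop}$ (resp. in $\mathsf{EpiTop}$); on maps, $[l]\mapsto[f\circ l]$. These are functors $\pi_1^{\mathrm{ps}}\colon\mathsf{PsTop}_*\to\mathsf{PsTopGrp}$ and $\pi_1^{\mathrm{epi}}\colon\mathsf{EpiTop}_*\to\mathsf{EpiTopGrp}$. Biss's functor $\pi_1^{\mathrm{Biss}}\colon\mathsf{Top}_*\to\mathsf{QTopGrp}$ is given in the same way by the loop space with the compact-open topology and the quotient topology. Let $R\colon\mathsf{PsTopGrp}\to\mathsf{QTopGrp}$ be the functor that keeps underlying groups and maps and replaces the pseudotopology by the topology in which $S$ is open iff $S\in\mathscr U$ whenever $\mathscr U\to x\in S$, and let $R_2$ be its restriction to $\mathsf{EpiTopGrp}$. **Proposition.** Up to the identification of the underlying groups that sends the class of each loop to the class of the same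 loop, the following equalities of functors $\mathsf{Top}_*\to\mathsf{QTopGrp}$ hold: $$R_2\circ\pi_1^{\mathrm{epi}}|_{\mathsf{Top}_*}=\pi_1^{\mathrm{Biss}},\qquad R\circ\pi_1^{\mathrm{ps}}|_{\mathsf{Top}_*}=\pi_1^{\mathrm{Biss}}.$$ That is, the identification is a natural isomorphism of quasitopological groups in both cases. -/

import Mathlib

open Filter Topology unitInterval CategoryTheory

universe u v w

/-! ### Pseudotopological spaces -/

/-- A pseudotopological structure on `X`: a relation between ultrafilters and points
(`Conv U x` reads `U → x`) such that every principal ultrafilter converges to its point. -/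
class PsSpace (X : Type u) where
  Conv : Ultrafilter X → X → Prop
  pure_conv : ∀ x, Conv (pure x) x

namespace PsSpace

/-- Convergence of a filter: all finer ultrafilters converge. -/
def FConv {X : Type u} [PsSpace X] (F : Filter X) (x : X) : Prop :=
  ∀ U : Ultrafilter X, (U : Filter X) ≤ F → Conv U x

end PsSpace

open PsSpace

/-- Continuity of a map between pseudospaces. -/
def PsCont {X : Type u} {Y : Type v} [PsSpace X] [PsSpace Y] (f : X → Y) : Prop :=
  ∀ (U : Ultrafilter X) (x : X), Conv U x → Conv (U.map f) (f x)

theorem PsCont.id {X : Type u} [PsSpace X] : PsCont (fun x : X => x) := fun U x h => by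
  simpa using h

theorem PsCont.comp {X : Type u} {Y : Type v} {Z : Type w} [PsSpace X] [PsSpace Y] [PsSpace Z]
    {g : Y → Z} {f : X → Y} (hg : PsCont g) (hf : PsCont f) : PsCont (fun x => g (f x)) :=
  fun U x h => by
    have := hg _ _ (hf U x h)
    rwa [Ultrafilter.map_map] at this

theorem PsCont.const {X : Type u} {Y : Type v} [PsSpace X] [PsSpace Y] (y : Y) :
    PsCont (fun _ : X => y) := fun U x _ => by
  have : U.map (fun _ : X => y) = pure y :=
    Ultrafilter.coe_injective (by simp [Filter.map_const])
  rw [this]; exact pure_conv y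

/-- The pseudotopology of a topological space: convergence of ultrafilters. -/
@[reducible] def PsSpace.ofTop (X : Type u) [TopologicalSpace X] : PsSpace X where
  Conv U x := (U : Filter X) ≤ 𝓝 x
  pure_conv x := pure_le_nhds x

/-- A topological space `X` viewed as a pseudospace. -/
def AsPs (X : Type u) : Type u := X

/-- A point of `X`, in `X` viewed as a pseudospace. -/
def AsPs.of {X : Type u} (x : X) : AsPs X := x

instance AsPs.instPsSpace (X : Type u) [TopologicalSpace X] : PsSpace (AsPs X) := PsSpace.ofTop X

instance : PsSpace I := PsSpace.ofTop I

theorem psCont_ofTop {X : Type u} {Y : Type v} [TopologicalSpace X] [TopologicalSpace Y]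
    {f : X → Y} (hf : Continuous f) : @PsCont X Y (PsSpace.ofTop X) (PsSpace.ofTop Y) f :=
  fun U x h => by
    change Filter.map f U ≤ 𝓝 (f x)
    exact (Filter.map_mono h).trans (hf.tendsto x)

theorem psCont_asPs {X : Type u} {Y : Type v} [TopologicalSpace X] [TopologicalSpace Y]
    {f : X → Y} (hf : Continuous f) : @PsCont (AsPs X) (AsPs Y) _ _ f :=
  psCont_ofTop (X := X) (Y := Y) hf

/-- The product pseudotopology (initial with respect to the two projections). -/
instance PsSpace.prod {X : Type u} {Y : Type v} [PsSpace X] [PsSpace Y] : PsSpace (X × Y) where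
  Conv W p := Conv (W.map Prod.fst) p.1 ∧ Conv (W.map Prod.snd) p.2
  pure_conv p := by
    simp only [Ultrafilter.map_pure]
    exact ⟨pure_conv _, pure_conv _⟩

theorem PsCont.fst {X : Type u} {Y : Type v} [PsSpace X] [PsSpace Y] :
    PsCont (Prod.fst : X × Y → X) := fun _ _ h => h.1

theorem PsCont.snd {X : Type u} {Y : Type v} [PsSpace X] [PsSpace Y] :
    PsCont (Prod.snd : X × Y → Y) := fun _ _ h => h.2

theorem PsCont.prodMk {A : Type w} {X : Type u} {Y : Type v} [PsSpace A] [PsSpace X] [PsSpace Y]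
    {f : A → X} {g : A → Y} (hf : PsCont f) (hg : PsCont g) : PsCont (fun a => (f a, g a)) :=
  fun U a h => by
    refine ⟨?_, ?_⟩
    · rw [Ultrafilter.map_map]; exact hf U a h
    · rw [Ultrafilter.map_map]; exact hg U a h

/-! ### Ultrafilter lemmas -/

theorem ultra_map_congr {A : Type u} {B : Type v} {U : Ultrafilter A} {f g : A → B}
    (h : ∀ᶠ a in (U : Filter A), f a = g a) : U.map f = U.map g :=
  Ultrafilter.coe_injective (Filter.map_congr h)

theorem ultra_exists_amalg {A : Type u} {P : Type v} {B : Type w} (f : A → B) (g : P → B)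
    (U : Ultrafilter A) (W : Ultrafilter P) (h : U.map f = W.map g) :
    ∃ T : Ultrafilter (A × P), T.map Prod.fst = U ∧ T.map Prod.snd = W ∧
      ∀ᶠ q in (T : Filter (A × P)), f q.1 = g q.2 := by
  have hne : NeBot ((comap Prod.fst (U : Filter A) ⊓ comap Prod.snd (W : Filter P)) ⊓
      𝓟 {q : A × P | f q.1 = g q.2}) := by
    rw [Filter.inf_principal_neBot_iff]
    intro S hS
    obtain ⟨S₁, ⟨a, ha, ha'⟩, S₂, ⟨b, hb, hb'⟩, rfl⟩ := Filter.mem_inf_iff.1 hS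
    have h1 : f '' a ∈ W.map g := by
      rw [← h, Ultrafilter.mem_map]
      exact mem_of_superset ha (Set.subset_preimage_image f a)
    have h2 : g ⁻¹' (f '' a) ∩ b ∈ (W : Filter P) := inter_mem h1 hb
    obtain ⟨p, ⟨x, hx, hxp⟩, hp⟩ := W.nonempty_of_mem h2
    exact ⟨(x, p), ⟨ha' hx, hb' hp⟩, hxp⟩
  obtain ⟨T, hT⟩ := Ultrafilter.exists_le ((comap Prod.fst (U : Filter A) ⊓
    comap Prod.snd (W : Filter P)) ⊓ 𝓟 {q : A × P | f q.1 = g q.2})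
  refine ⟨T, ?_, ?_, ?_⟩
  · exact Ultrafilter.coe_le_coe.1 (Filter.map_le_iff_le_comap.2
      (hT.trans (inf_le_left.trans inf_le_left)))
  · exact Ultrafilter.coe_le_coe.1 (Filter.map_le_iff_le_comap.2
      (hT.trans (inf_le_left.trans inf_le_right)))
  · exact hT (mem_inf_of_right (mem_principal_self _))

theorem ultra_exists_lift {A : Type u} {B : Type v} (f : A → B) (G : Filter A)
    (W : Ultrafilter B) (h : (W : Filter B) ≤ Filter.map f G) :
    ∃ V : Ultrafilter A, (V : Filter A) ≤ G ∧ V.map f = W := by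
  have hne : NeBot (G ⊓ comap f (W : Filter B)) := by
    rw [← Filter.map_neBot_iff f, Filter.push_pull]
    rw [inf_eq_right.2 h]
    infer_instance
  obtain ⟨V, hV⟩ := Ultrafilter.exists_le (G ⊓ comap f (W : Filter B))
  exact ⟨V, hV.trans inf_le_left, Ultrafilter.coe_le_coe.1
    (Filter.map_le_iff_le_comap.2 (hV.trans inf_le_right))⟩

/-! ### Function spaces -/

/-- The set `PsTop(X, Y)` of continuous maps between pseudospaces. -/
structure PsMap (X : Type u) (Y : Type v) [PsSpace X] [PsSpace Y] where
  toFun : X → Y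
  cont : PsCont toFun

namespace PsMap

variable {X : Type u} {Y : Type v} [PsSpace X] [PsSpace Y]

instance : FunLike (PsMap X Y) X Y where
  coe := toFun
  coe_injective f g h := by cases f; cases g; congr

@[ext] theorem ext {f g : PsMap X Y} (h : ∀ x, f x = g x) : f = g := DFunLike.ext _ _ h

@[simp] theorem mk_apply (f : X → Y) (hf : PsCont f) (x : X) : (PsMap.mk f hf) x = f x := rfl

theorem psCont (f : PsMap X Y) : PsCont f := f.cont

/-- The exponential pseudotopology `Y ^ X`: `F → f` iff `ev_* (F × G) → f x` whenever `G → x`. -/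
instance : PsSpace (PsMap X Y) where
  Conv F f := ∀ (G : Filter X) (x : X), FConv G x →
    FConv (Filter.map (fun p : PsMap X Y × X => p.1 p.2) ((F : Filter (PsMap X Y)) ×ˢ G)) (f x)
  pure_conv f := by
    intro G x hG W hW
    rw [Ultrafilter.coe_pure, Filter.pure_prod, Filter.map_map] at hW
    obtain ⟨V, hV, rfl⟩ := ultra_exists_lift _ _ _ hW
    exact f.cont V x (hG V hV)

theorem conv_iff {F : Ultrafilter (PsMap X Y)} {f : PsMap X Y} :
    Conv F f ↔ ∀ (W : Ultrafilter (PsMap X Y × X)) (x : X), W.map Prod.fst = F →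
      Conv (W.map Prod.snd) x → Conv (W.map (fun p => p.1 p.2)) (f x) := by
  constructor
  · rintro h W x rfl hx
    refine h (W.map Prod.snd) x ?_ _ ?_
    · intro U hU
      rwa [Ultrafilter.coe_le_coe.1 hU]
    · exact Filter.map_mono Filter.le_prod_map_fst_snd
  · intro h G x hG U hU
    obtain ⟨W, hW, rfl⟩ := ultra_exists_lift _ _ _ hU
    refine h W x ?_ (hG _ ?_)
    · exact Ultrafilter.coe_le_coe.1
        ((Filter.map_mono hW).trans Filter.tendsto_fst)
    · exact (Filter.map_mono hW).trans Filter.tendsto_snd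

theorem psCont_eval : PsCont (fun p : PsMap X Y × X => p.1 p.2) :=
  fun W p h => conv_iff.1 h.1 W p.2 rfl h.2

theorem psCont_curry {A : Type w} [PsSpace A] {h : A → X → Y}
    (hh : PsCont (fun p : A × X => h p.1 p.2)) (k : A → PsMap X Y) (hk : ∀ a x, k a x = h a x) :
    PsCont k := by
  intro U a ha
  rw [conv_iff]
  intro W x hW hx
  obtain ⟨T, hT1, hT2, hT3⟩ := ultra_exists_amalg k Prod.fst U W hW.symm
  have h1 : Conv (T.map (fun q => (q.1, q.2.2))) (a, x) := by
    refine ⟨?_, ?_⟩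
    · rw [Ultrafilter.map_map]
      change Conv (T.map Prod.fst) a
      rwa [hT1]
    · rw [Ultrafilter.map_map]
      rw [← hT2, Ultrafilter.map_map] at hx
      exact hx
  have h2 := hh _ _ h1
  rw [hk, ← hT2, Ultrafilter.map_map]
  rw [Ultrafilter.map_map] at h2
  convert h2 using 1
  refine ultra_map_congr (hT3.mono ?_)
  rintro ⟨a', f', x'⟩ h'
  simp only at h'
  simp [← h', hk]

end PsMap

/-! ### Pasting along the midpoint, and concatenation -/

theorem PsCont.ite_half {A : Type u} {X : Type v} [PsSpace A] [PsSpace X] {τ : A → I}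
    (hτ : PsCont τ) {g h : A → X} (hg : PsCont g) (hh : PsCont h)
    (e : ∀ a, (τ a : ℝ) = 1 / 2 → g a = h a) :
    PsCont (fun a => if (τ a : ℝ) ≤ 1 / 2 then g a else h a) := by
  intro U a ha
  have hc := hτ U a ha
  change Filter.map τ U ≤ 𝓝 (τ a) at hc
  rcases U.mem_or_compl_mem {a | (τ a : ℝ) ≤ 1 / 2} with hU | hU
  · have h1 : (τ a : ℝ) ≤ 1 / 2 := by
      have hcl : IsClosed {t : I | (t : ℝ) ≤ 1 / 2} :=
        isClosed_le continuous_subtype_val continuous_const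
      have hc' : Tendsto τ (U : Filter A) (𝓝 (τ a)) := hc
      have : τ a ∈ {t : I | (t : ℝ) ≤ 1 / 2} := hcl.mem_of_tendsto hc' hU
      exact this
    have h2 : U.map (fun a => if (τ a : ℝ) ≤ 1 / 2 then g a else h a) = U.map g :=
      ultra_map_congr (mem_of_superset hU fun x hx => if_pos hx)
    rw [h2]
    simpa only [if_pos h1] using hg U a ha
  · have h1 : 1 / 2 ≤ (τ a : ℝ) := by
      have hcl : IsClosed {t : I | 1 / 2 ≤ (t : ℝ)} :=
        isClosed_le continuous_const continuous_subtype_val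
      have hc' : Tendsto τ (U : Filter A) (𝓝 (τ a)) := hc
      have : τ a ∈ {t : I | 1 / 2 ≤ (t : ℝ)} := by
        refine hcl.mem_of_tendsto hc' (mem_of_superset hU ?_)
        intro x hx
        exact (not_le.1 (show ¬ (τ x : ℝ) ≤ 1 / 2 from hx)).le
      exact this
    have h3 : U.map (fun a => if (τ a : ℝ) ≤ 1 / 2 then g a else h a) = U.map h :=
      ultra_map_congr (mem_of_superset hU fun x hx => if_neg hx)
    rw [h3]
    have : (if (τ a : ℝ) ≤ 1 / 2 then g a else h a) = h a := by
      split_ifs with h2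
      · exact e a (le_antisymm h2 h1)
      · rfl
    simp only [this]
    exact hh U a ha

/-- The point of `[0, 1]` nearest to a real number. -/
noncomputable def clampI (t : ℝ) : I := Set.projIcc 0 1 zero_le_one t

theorem clampI_of_mem {t : ℝ} (h0 : 0 ≤ t) (h1 : t ≤ 1) : clampI t = ⟨t, h0, h1⟩ :=
  Set.projIcc_of_mem zero_le_one ⟨h0, h1⟩

theorem coe_clampI (t : ℝ) : (clampI t : ℝ) = max 0 (min 1 t) := rfl

theorem psCont_clampI {f : I → ℝ} (hf : Continuous f) : PsCont (fun t => clampI (f t)) :=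
  psCont_ofTop (continuous_projIcc.comp hf)

/-- Concatenation of `f` and `g`: first `f`, then `g`, each at double speed. -/
noncomputable def concatI {X : Type u} (f g : I → X) (t : I) : X :=
  if (t : ℝ) ≤ 1 / 2 then f (clampI (2 * t)) else g (clampI (2 * t - 1))

theorem concatI_zero {X : Type u} (f g : I → X) : concatI f g 0 = f 0 := by
  have : clampI (2 * ((0 : I) : ℝ)) = 0 := by ext; simp [coe_clampI]
  unfold concatI
  rw [if_pos (by norm_num), this]

theorem concatI_one {X : Type u} (f g : I → X) : concatI f g 1 = g 1 := by
  have : clampI (2 * ((1 : I) : ℝ) - 1) = 1 := by ext; norm_num [coe_clampI]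
  unfold concatI
  rw [if_neg (by norm_num), this]

theorem psCont_concat {A : Type u} {X : Type v} [PsSpace A] [PsSpace X] {f g : A → I → X}
    (hf : PsCont (fun p : A × I => f p.1 p.2)) (hg : PsCont (fun p : A × I => g p.1 p.2))
    (e : ∀ a, f a 1 = g a 0) : PsCont (fun p : A × I => concatI (f p.1) (g p.1) p.2) := by
  refine PsCont.ite_half (τ := Prod.snd) PsCont.snd
    (hf.comp (PsCont.prodMk PsCont.fst ((psCont_clampI (f := fun t => 2 * (t : ℝ))
      (by fun_prop)).comp PsCont.snd)))
    (hg.comp (PsCont.prodMk PsCont.fst ((psCont_clampI (f := fun t => 2 * (t : ℝ) - 1)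
      (by fun_prop)).comp PsCont.snd))) ?_
  rintro ⟨a, t⟩ ht
  simp only at ht
  have h1 : clampI (2 * (t : ℝ)) = 1 := by ext; rw [ht]; norm_num [coe_clampI]
  have h0 : clampI (2 * (t : ℝ) - 1) = 0 := by ext; rw [ht]; norm_num [coe_clampI]
  simp only [h1, h0, e]

theorem psCont_concat' {X : Type v} [PsSpace X] {f g : I → X}
    (hf : PsCont f) (hg : PsCont g) (e : f 1 = g 0) : PsCont (concatI f g) := by
  have := psCont_concat (A := I) (f := fun _ => f) (g := fun _ => g) (hf.comp PsCont.snd)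
    (hg.comp PsCont.snd) (fun _ => e)
  exact this.comp (PsCont.prodMk PsCont.id PsCont.id)

theorem psCont_symmI : PsCont (fun t : I => σ t) := psCont_ofTop unitInterval.continuous_symm

/-! ### Path components -/

/-- Two points are joined if a continuous path `[0, 1] → X` leads from one to the other. -/
def PsJoined {X : Type u} [PsSpace X] (x y : X) : Prop :=
  ∃ γ : PsMap I X, γ 0 = x ∧ γ 1 = y

theorem PsJoined.map {X : Type u} {Y : Type v} [PsSpace X] [PsSpace Y] {f : X → Y}
    (hf : PsCont f) {x x' : X} (h : PsJoined x x') : PsJoined (f x) (f x') := by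
  obtain ⟨γ, rfl, rfl⟩ := h
  exact ⟨⟨fun t => f (γ t), hf.comp γ.cont⟩, rfl, rfl⟩

theorem PsJoined.prod {X : Type u} {Y : Type v} [PsSpace X] [PsSpace Y]
    {x x' : X} {y y' : Y} (h : PsJoined x x') (h' : PsJoined y y') :
    PsJoined (x, y) (x', y') := by
  obtain ⟨γ, rfl, rfl⟩ := h
  obtain ⟨δ, rfl, rfl⟩ := h'
  exact ⟨⟨fun t => (γ t, δ t), PsCont.prodMk γ.cont δ.cont⟩, rfl, rfl⟩

/-- Being joined by a path is an equivalence relation. -/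
def psPathSetoid (X : Type u) [PsSpace X] : Setoid X where
  r := PsJoined
  iseqv :=
    { refl := fun x => ⟨⟨fun _ => x, PsCont.const x⟩, rfl, rfl⟩
      symm := by
        rintro _ _ ⟨γ, rfl, rfl⟩
        exact ⟨⟨fun t => γ (σ t), γ.cont.comp psCont_symmI⟩, by simp, by simp⟩
      trans := by
        rintro _ _ _ ⟨γ, rfl, rfl⟩ ⟨δ, h, rfl⟩
        exact ⟨⟨concatI γ δ, psCont_concat' γ.cont δ.cont h.symm⟩,
          concatI_zero _ _, concatI_one _ _⟩ }

/-- The set of path components of a pseudospace. -/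
def PathComp (X : Type u) [PsSpace X] : Type u := Quotient (psPathSetoid X)

namespace PathComp

variable {X : Type u} [PsSpace X] {Y : Type v} [PsSpace Y] {Z : Type w} [PsSpace Z]

/-- The projection of a pseudospace onto its set of path components. -/
def mk (x : X) : PathComp X := Quotient.mk (psPathSetoid X) x

theorem mk_surjective : Function.Surjective (mk (X := X)) := Quotient.exists_rep

theorem sound {x y : X} (h : PsJoined x y) : mk x = mk y := Quotient.sound h

/-- The quotient (i.e. final) pseudotopology on the set of path components. As the projection is
surjective, all the principal ultrafilters are among the images. -/
instance : PsSpace (PathComp X) where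
  Conv V q := ∃ (U : Ultrafilter X) (x : X), Conv U x ∧ U.map mk = V ∧ mk x = q
  pure_conv q := by
    obtain ⟨x, rfl⟩ := mk_surjective q
    exact ⟨pure x, x, pure_conv x, Ultrafilter.map_pure _ _, rfl⟩

theorem psCont_mk : PsCont (mk (X := X)) := fun U x h => ⟨U, x, h, rfl, rfl⟩

theorem psCont_iff {f : PathComp X → Y} : PsCont f ↔ PsCont (fun x => f (mk x)) := by
  refine ⟨fun h => h.comp psCont_mk, ?_⟩
  rintro h _ _ ⟨U, x, hU, rfl, rfl⟩
  rw [Ultrafilter.map_map]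
  exact h U x hU

/-- The map on path components induced by a continuous map. -/
def map (f : X → Y) (hf : PsCont f) : PathComp X → PathComp Y :=
  Quotient.lift (fun x => mk (f x)) fun _ _ h => sound (PsJoined.map hf h)

@[simp] theorem map_mk (f : X → Y) (hf : PsCont f) (x : X) : map f hf (mk x) = mk (f x) := rfl

theorem psCont_map (f : X → Y) (hf : PsCont f) : PsCont (map f hf) :=
  psCont_iff.2 (psCont_mk.comp hf)

/-- The binary operation on path components induced by a continuous operation. -/
def map₂ (m : X → Y → Z) (hm : PsCont (fun p : X × Y => m p.1 p.2)) :
    PathComp X → PathComp Y → PathComp Z :=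
  Quotient.lift₂ (fun x y => mk (m x y)) fun _ _ _ _ h h' =>
    sound (PsJoined.map hm (PsJoined.prod h h'))

@[simp] theorem map₂_mk (m : X → Y → Z) (hm : PsCont (fun p : X × Y => m p.1 p.2)) (x : X)
    (y : Y) : map₂ m hm (mk x) (mk y) = mk (m x y) := rfl

theorem psCont_map₂ (m : X → Y → Z) (hm : PsCont (fun p : X × Y => m p.1 p.2)) :
    PsCont (fun p : PathComp X × PathComp Y => map₂ m hm p.1 p.2) := by
  rintro W ⟨q, r⟩ ⟨⟨U, x, hU, hUW, rfl⟩, ⟨V, y, hV, hVW, hr⟩⟩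
  simp only at hr
  subst hr
  obtain ⟨T, hT1, hT2, hT3⟩ := ultra_exists_amalg mk Prod.fst U W hUW
  rw [← hT2, Ultrafilter.map_map] at hVW
  obtain ⟨S, hS1, hS2, hS3⟩ := ultra_exists_amalg mk _ V T hVW
  refine ⟨S.map (fun s => m s.2.1 s.1), m x y, ?_, ?_, rfl⟩
  · have h : Conv (S.map (fun s => (s.2.1, s.1))) (x, y) := by
      refine ⟨?_, ?_⟩
      · rw [Ultrafilter.map_map]
        rw [← hT1, ← hS2, Ultrafilter.map_map] at hU
        exact hU
      · rw [Ultrafilter.map_map]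
        rw [← hS1] at hV
        exact hV
    have := hm _ _ h
    rwa [Ultrafilter.map_map] at this
  · rw [← hT2, ← hS2, Ultrafilter.map_map, Ultrafilter.map_map, Ultrafilter.map_map]
    refine ultra_map_congr ?_
    have hT3' : ∀ᶠ s in (S : Filter (Y × X × PathComp X × PathComp Y)), mk s.2.1 = s.2.2.1 := by
      rw [← hS2] at hT3
      exact hT3
    filter_upwards [hS3, hT3'] with s h1 h2
    simp only [Function.comp] at h1 ⊢
    rw [← h2, ← h1]
    rfl

end PathComp

/-! ### Loop spaces and the pseudotopological fundamental group -/

/-- The set of loops in `X` based at `x₀`. -/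
structure PsLoop (X : Type u) [PsSpace X] (x₀ : X) : Type u where
  val : PsMap I X
  source : val 0 = x₀
  target : val 1 = x₀

namespace PsLoop

variable {X : Type u} [PsSpace X] {x₀ : X} {Y : Type v} [PsSpace Y]

/-- The loop space carries the subspace (i.e. initial) structure inherited from the function
space `X ^ [0, 1]`. -/
instance : PsSpace (PsLoop X x₀) where
  Conv U l := Conv (U.map val) l.val
  pure_conv l := by rw [Ultrafilter.map_pure]; exact pure_conv _

theorem psCont_val : PsCont (fun l : PsLoop X x₀ => l.val) := fun _ _ h => h

theorem psCont_eval : PsCont (fun p : PsLoop X x₀ × I => p.1.val p.2) :=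
  PsMap.psCont_eval.comp (PsCont.prodMk (psCont_val.comp PsCont.fst) PsCont.snd)

theorem psCont_curry {A : Type w} [PsSpace A] {h : A → I → X}
    (hh : PsCont (fun p : A × I => h p.1 p.2)) (k : A → PsLoop X x₀)
    (hk : ∀ a t, (k a).val t = h a t) : PsCont k := by
  intro U a ha
  have := PsMap.psCont_curry hh (fun a => (k a).val) hk U a ha
  change Conv ((U.map k).map val) (k a).val
  rwa [Ultrafilter.map_map]

/-- The constant loop. -/
def one : PsLoop X x₀ := ⟨⟨fun _ => x₀, PsCont.const x₀⟩, rfl, rfl⟩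

/-- Concatenation of loops: first `l`, then `m`. -/
noncomputable def mul (l m : PsLoop X x₀) : PsLoop X x₀ :=
  ⟨⟨concatI l.val m.val, psCont_concat' l.val.cont m.val.cont (l.target.trans m.source.symm)⟩,
    (concatI_zero _ _).trans l.source, (concatI_one _ _).trans m.target⟩

/-- The reverse loop. -/
def inv (l : PsLoop X x₀) : PsLoop X x₀ :=
  ⟨⟨fun t => l.val (σ t), l.val.cont.comp psCont_symmI⟩,
    by simpa using l.target, by simpa using l.source⟩

theorem psCont_mul : PsCont (fun p : PsLoop X x₀ × PsLoop X x₀ => mul p.1 p.2) := by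
  refine psCont_curry (h := fun p => concatI p.1.val p.2.val) ?_ _ (fun _ _ => rfl)
  refine psCont_concat (f := fun p : PsLoop X x₀ × PsLoop X x₀ => (p.1.val : I → X))
    (g := fun p : PsLoop X x₀ × PsLoop X x₀ => (p.2.val : I → X)) ?_ ?_
    (fun p => p.1.target.trans p.2.source.symm)
  · exact psCont_eval.comp (PsCont.prodMk (PsCont.fst.comp PsCont.fst) PsCont.snd)
  · exact psCont_eval.comp (PsCont.prodMk (PsCont.snd.comp PsCont.fst) PsCont.snd)

theorem psCont_inv : PsCont (inv : PsLoop X x₀ → PsLoop X x₀) :=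
  psCont_curry (h := fun l t => l.val (σ t))
    (psCont_eval.comp (PsCont.prodMk PsCont.fst (psCont_symmI.comp PsCont.snd))) _
    (fun _ _ => rfl)

/-- The map of loop spaces induced by a based continuous map. -/
def map (f : X → Y) (hf : PsCont f) {y₀ : Y} (h : f x₀ = y₀) (l : PsLoop X x₀) : PsLoop Y y₀ :=
  ⟨⟨fun t => f (l.val t), hf.comp l.val.cont⟩,
    (congrArg f l.source).trans h, (congrArg f l.target).trans h⟩

theorem psCont_map (f : X → Y) (hf : PsCont f) {y₀ : Y} (h : f x₀ = y₀) :
    PsCont (map f hf h) :=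
  psCont_curry (h := fun l t => f (l.val t)) (hf.comp psCont_eval) _ (fun _ _ => rfl)

theorem ext {l m : PsLoop X x₀} (h : ∀ t, l.val t = m.val t) : l = m :=
  by
  cases l
  cases m
  congr
  exact PsMap.ext h

theorem psCont_interp {φ ψ : I → ℝ} (hφ : Continuous φ) (hψ : Continuous ψ) :
    PsCont (fun x : I × I => clampI ((1 - (x.1 : ℝ)) * φ x.2 + x.1 * ψ x.2)) := by
  have hc : Continuous (fun x : I × I => clampI ((1 - (x.1 : ℝ)) * φ x.2 + x.1 * ψ x.2)) :=
    continuous_projIcc.comp (by fun_prop)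
  intro U x hU
  refine psCont_ofTop hc U x ?_
  change (U : Filter (I × I)) ≤ 𝓝 x
  rw [nhds_prod_eq]
  exact Filter.le_prod_map_fst_snd.trans (Filter.prod_mono hU.1 hU.2)

theorem joined_of_reparam (l p q : PsLoop X x₀) {φ ψ : I → ℝ} (hφ : Continuous φ)
    (hψ : Continuous ψ) (hp : ∀ t, p.val t = l.val (clampI (φ t)))
    (hq : ∀ t, q.val t = l.val (clampI (ψ t))) (h0 : φ 0 = ψ 0) (h1 : φ 1 = ψ 1) :
    PsJoined p q := by
  have e0 (s : I) : (1 - (s : ℝ)) * φ 0 + s * ψ 0 = φ 0 := by rw [← h0]; ring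
  have e1 (s : I) : (1 - (s : ℝ)) * φ 1 + s * ψ 1 = φ 1 := by rw [← h1]; ring
  have hH := psCont_interp hφ hψ
  have hc (s : I) : PsCont (fun t : I => clampI ((1 - (s : ℝ)) * φ t + s * ψ t)) :=
    PsCont.comp (f := fun t : I => (s, t))
      (g := fun x : I × I => clampI ((1 - (x.1 : ℝ)) * φ x.2 + x.1 * ψ x.2)) hH
      (PsCont.prodMk (PsCont.const s) PsCont.id)
  have hs (s : I) : ∃ m : PsLoop X x₀,
      ∀ t, m.val t = l.val (clampI ((1 - (s : ℝ)) * φ t + s * ψ t)) := by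
    refine ⟨⟨⟨fun t => l.val (clampI ((1 - (s : ℝ)) * φ t + s * ψ t)), ?_⟩, ?_, ?_⟩, ?_⟩
    · exact PsCont.comp (g := l.val) l.val.psCont (hc s)
    · rw [PsMap.mk_apply, e0, ← hp]
      exact p.source
    · rw [PsMap.mk_apply, e1, ← hp]
      exact p.target
    · intro t
      rfl
  choose H hHs using hs
  have hcH : PsCont H := psCont_curry
    (h := fun s t : I => l.val (clampI ((1 - (s : ℝ)) * φ t + s * ψ t)))
    (PsCont.comp (g := l.val) l.val.psCont hH) _ hHs
  have E0 : H 0 = p := by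
    apply ext
    intro t
    rw [hHs, hp]
    simp
  have E1 : H 1 = q := by
    apply ext
    intro t
    rw [hHs, hq]
    simp
  exact ⟨⟨H, hcH⟩, E0, E1⟩

end PsLoop

theorem concatI_left {X : Type u} (f g : I → X) {t s : I} (h : (t : ℝ) ≤ 1 / 2)
    (hs : (s : ℝ) = 2 * t) : concatI f g t = f s := by
  unfold concatI
  rw [if_pos h, ← hs, clampI, Set.projIcc_val]

theorem concatI_right {X : Type u} (f g : I → X) {t s : I} (h : ¬ (t : ℝ) ≤ 1 / 2)
    (hs : (s : ℝ) = 2 * t - 1) : concatI f g t = g s := by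
  unfold concatI
  rw [if_neg h, ← hs, clampI, Set.projIcc_val]

theorem concatI_assoc {X : Type u} (f g h : I → X) (t : I) :
    concatI (concatI f g) h t =
      concatI f (concatI g h) (clampI (min (2 * t) (min (t + 1 / 4) ((t + 1) / 2)))) := by
  obtain ⟨t, t0, t1⟩ := t
  simp only
  by_cases h1 : t ≤ 1 / 4
  · have e : min (2 * t) (min (t + 1 / 4) ((t + 1) / 2)) = 2 * t :=
      min_eq_left (le_min (by linarith) (by linarith))
    rw [e, clampI_of_mem (by linarith) (by linarith),
      concatI_left (s := ⟨2 * t, by linarith, by linarith⟩) _ _ (by simp only; linarith) rfl,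
      concatI_left (s := ⟨2 * (2 * t), by linarith, by linarith⟩) _ _ (by simp only; linarith) rfl,
      concatI_left (s := ⟨2 * (2 * t), by linarith, by linarith⟩) _ _ (by simp only; linarith) rfl]
  · rw [not_le] at h1
    by_cases h2 : t ≤ 1 / 2
    · have e : min (2 * t) (min (t + 1 / 4) ((t + 1) / 2)) = t + 1 / 4 := by
        rw [min_eq_left (a := t + 1 / 4) (by linarith), min_eq_right (by linarith)]
      rw [e, clampI_of_mem (by linarith) (by linarith),
        concatI_left (s := ⟨2 * t, by linarith, by linarith⟩) _ _ (by simp only; linarith) rfl,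
        concatI_right (s := ⟨2 * (2 * t) - 1, by linarith, by linarith⟩) _ _
          (by simp only; linarith) rfl,
        concatI_right (s := ⟨2 * t - 1 / 2, by linarith, by linarith⟩) _ _
          (by simp only; linarith) (by simp only; ring),
        concatI_left (s := ⟨2 * (2 * t) - 1, by linarith, by linarith⟩) _ _
          (by simp only; linarith) (by simp only; ring)]
    · rw [not_le] at h2
      have e : min (2 * t) (min (t + 1 / 4) ((t + 1) / 2)) = (t + 1) / 2 := by
        rw [min_eq_right (a := t + 1 / 4) (by linarith), min_eq_right (by linarith)]
      rw [e, clampI_of_mem (by linarith) (by linarith),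
        concatI_right (s := ⟨2 * t - 1, by linarith, by linarith⟩) _ _
          (by simp only; linarith) rfl,
        concatI_right (s := ⟨t, by linarith, by linarith⟩) _ _
          (by simp only; linarith) (by simp only; ring),
        concatI_right (s := ⟨2 * t - 1, by linarith, by linarith⟩) _ _
          (by simp only; linarith) rfl]

/-- The underlying set of the fundamental group: the path components of the loop space, with the
quotient pseudotopology. -/
abbrev PsPi1 (X : Type u) [PsSpace X] (x₀ : X) : Type u := PathComp (PsLoop X x₀)

namespace PsPi1

variable {X : Type u} [PsSpace X] {x₀ : X} {Y : Type v} [PsSpace Y] {y₀ : Y}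

noncomputable instance : Mul (PsPi1 X x₀) := ⟨PathComp.map₂ PsLoop.mul PsLoop.psCont_mul⟩
instance : One (PsPi1 X x₀) := ⟨PathComp.mk PsLoop.one⟩
instance : Inv (PsPi1 X x₀) := ⟨PathComp.map PsLoop.inv PsLoop.psCont_inv⟩

theorem mul_mk (l m : PsLoop X x₀) :
    (PathComp.mk l * PathComp.mk m : PsPi1 X x₀) = PathComp.mk (l.mul m) := rfl

theorem psCont_mul : PsCont (fun p : PsPi1 X x₀ × PsPi1 X x₀ => p.1 * p.2) :=
  PathComp.psCont_map₂ _ PsLoop.psCont_mul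

theorem psCont_inv : PsCont (fun p : PsPi1 X x₀ => p⁻¹) :=
  PathComp.psCont_map _ PsLoop.psCont_inv

theorem mul_assoc' (a b c : PsPi1 X x₀) : a * b * c = a * (b * c) := by
  obtain ⟨a, rfl⟩ := PathComp.mk_surjective a
  obtain ⟨b, rfl⟩ := PathComp.mk_surjective b
  obtain ⟨c, rfl⟩ := PathComp.mk_surjective c
  refine PathComp.sound (PsLoop.joined_of_reparam (a.mul (b.mul c)) _ _
    (φ := fun t => min (2 * (t : ℝ)) (min (t + 1 / 4) ((t + 1) / 2))) (ψ := fun t => t)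
    (by fun_prop) (by fun_prop) (fun t => concatI_assoc _ _ _ t) (fun t => ?_) ?_ ?_)
  · rw [clampI, Set.projIcc_val]
  · norm_num
  · norm_num

theorem one_mul' (a : PsPi1 X x₀) : 1 * a = a := by
  obtain ⟨a, rfl⟩ := PathComp.mk_surjective a
  refine PathComp.sound (PsLoop.joined_of_reparam a _ _
    (φ := fun t => max 0 (2 * (t : ℝ) - 1)) (ψ := fun t => t)
    (by fun_prop) (by fun_prop) (fun t => ?_) (fun t => ?_) ?_ ?_)
  · change concatI (fun _ => x₀) a.val t = _
    by_cases h : (t : ℝ) ≤ 1 / 2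
    · rw [max_eq_left (by linarith), clampI_of_mem le_rfl zero_le_one, concatI, if_pos h]
      exact a.source.symm
    · rw [max_eq_right (by linarith), concatI, if_neg h]
  · rw [clampI, Set.projIcc_val]
  · norm_num
  · norm_num

theorem inv_mul' (a : PsPi1 X x₀) : a⁻¹ * a = 1 := by
  obtain ⟨a, rfl⟩ := PathComp.mk_surjective a
  refine PathComp.sound (PsLoop.joined_of_reparam a _ _
    (φ := fun t => |2 * (t : ℝ) - 1|) (ψ := fun _ => 1)
    (by fun_prop) (by fun_prop) (fun t => ?_) (fun t => ?_) ?_ ?_)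
  · change concatI (fun t => a.val (σ t)) a.val t = _
    by_cases h : (t : ℝ) ≤ 1 / 2
    · have h0 := t.2.1
      rw [abs_of_nonpos (by linarith),
        concatI_left (s := ⟨2 * t, by linarith, by linarith⟩) _ _ h rfl,
        clampI_of_mem (by linarith) (by linarith)]
      congr 1
      ext
      simp
    · rw [abs_of_nonneg (by linarith), concatI, if_neg h]
  · rw [clampI_of_mem zero_le_one le_rfl]
    exact a.target.symm
  · norm_num
  · norm_num

/-- The group structure induced by concatenation of loops. -/
noncomputable instance : Group (PsPi1 X x₀) :=
  Group.ofLeftAxioms mul_assoc' one_mul' inv_mul'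

/-- The homomorphism `[l] ↦ [f ∘ l]` induced by a based continuous map. -/
noncomputable def map (f : X → Y) (hf : PsCont f) (h : f x₀ = y₀) : PsPi1 X x₀ →* PsPi1 Y y₀ :=
  MonoidHom.mk' (PathComp.map (PsLoop.map f hf h) (PsLoop.psCont_map f hf h)) (by
    intro a b
    obtain ⟨a, rfl⟩ := PathComp.mk_surjective a
    obtain ⟨b, rfl⟩ := PathComp.mk_surjective b
    refine congrArg PathComp.mk (PsLoop.ext fun t => ?_)
    change f (concatI a.val b.val t) = concatI (fun t => f (a.val t)) (fun t => f (b.val t)) t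
    unfold concatI
    split_ifs <;> rfl)

theorem psCont_map (f : X → Y) (hf : PsCont f) (h : f x₀ = y₀) : PsCont (map f hf h) :=
  PathComp.psCont_map _ (PsLoop.psCont_map f hf h)

end PsPi1

/-! ### Epitopological spaces -/

/-- `X` is epitopological: it carries the initial pseudotopology with respect to some collection of
maps `X → Z_j ^ Y_j` with topological spaces `Y_j`, `Z_j`. -/
def IsEpi (X : Type u) [PsSpace X] : Prop :=
  ∃ (J : Type (u + 1)) (Y Z : J → Type u) (_ : ∀ j, TopologicalSpace (Y j))
    (_ : ∀ j, TopologicalSpace (Z j)) (f : ∀ j, X → PsMap (AsPs (Y j)) (AsPs (Z j))),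
    ∀ (U : Ultrafilter X) (x : X), Conv U x ↔ ∀ j, Conv (U.map (f j)) (f j x)

/-- Every topological space is epitopological. -/
theorem isEpi_asPs (X : Type u) [TopologicalSpace X] : IsEpi (AsPs X) := by
  let f : AsPs X → PsMap (AsPs PUnit.{u + 1}) (AsPs X) := fun x => ⟨fun _ => x, PsCont.const x⟩
  refine ⟨PUnit, fun _ => PUnit, fun _ => X, fun _ => inferInstance, fun _ => inferInstance,
    fun _ => f, fun U x => ⟨fun h _ => ?_, fun h => ?_⟩⟩
  · exact PsMap.psCont_curry (h := fun x _ => x) PsCont.fst f (fun _ _ => rfl) U x h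
  · let pt : AsPs PUnit.{u + 1} := PUnit.unit
    have h1 : Conv ((U.map f).map fun g => (g, pt)) (f x, pt) :=
      PsCont.prodMk PsCont.id (PsCont.const pt) _ _ (h PUnit.unit)
    have h2 := PsMap.psCont_eval _ _ h1
    rw [Ultrafilter.map_map, Ultrafilter.map_map] at h2
    change Conv (U.map fun x => x) x at h2
    rwa [Ultrafilter.map_id'] at h2

/-- The underlying set of the epitopological reflection `R₁ X`. -/
def EpiRefl (X : Type u) : Type u := X

/-- The structure of `R₁ X`: the initial one with respect to all continuous maps `X → Z ^ Y` with
topological `Y`, `Z`, i.e. the finest epitopology coarser than the given pseudotopology. -/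
instance (X : Type u) [PsSpace X] : PsSpace (EpiRefl X) where
  Conv U x := ∀ (Y Z : Type u) [TopologicalSpace Y] [TopologicalSpace Z]
    (f : X → PsMap (AsPs Y) (AsPs Z)), PsCont f → Conv (Ultrafilter.map f U) (f x)
  pure_conv x := by
    intro Y Z _ _ f _
    have : Ultrafilter.map f (pure x : Ultrafilter X) = pure (f x) := Ultrafilter.map_pure f x
    exact this ▸ pure_conv (f x)

namespace EpiRefl

variable {X : Type u} [PsSpace X]

/-- The identity map `X → R₁ X`. -/
def of (x : X) : EpiRefl X := x

theorem psCont_of : PsCont (of : X → EpiRefl X) := by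
  intro U x h Y Z _ _ f hf
  exact hf U x h

theorem isEpi : IsEpi (EpiRefl X) := by
  refine ⟨Σ' (Y Z : Type u) (_ : TopologicalSpace Y) (_ : TopologicalSpace Z),
    {f : X → PsMap (AsPs Y) (AsPs Z) // PsCont f}, fun j => j.1, fun j => j.2.1,
    fun j => j.2.2.1, fun j => j.2.2.2.1, fun j => j.2.2.2.2.1, fun U x => ?_⟩
  constructor
  · rintro h ⟨Y, Z, _, _, f, hf⟩
    exact h Y Z f hf
  · intro h Y Z _ _ f hf
    exact h ⟨Y, Z, inferInstance, inferInstance, f, hf⟩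

/-- The universal property of the reflection `R₁`. -/
theorem psCont_iff {E : Type u} [PsSpace E] (hE : IsEpi E) {f : EpiRefl X → E} :
    PsCont f ↔ PsCont (fun x : X => f (of x)) := by
  refine ⟨fun hf => hf.comp psCont_of, fun hf => ?_⟩
  obtain ⟨J, Y, Z, _, _, g, hg⟩ := hE
  intro U x h
  rw [hg]
  intro j
  have hgj : PsCont (g j) := fun V y hV => (hg V y).1 hV j
  have := h (Y j) (Z j) _ (hgj.comp hf)
  rw [Ultrafilter.map_map]
  exact this

end EpiRefl

/-- The topology in which the neighbourhoods of `s` are the members of `V` containing `s`, and all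
other points are isolated. -/
@[reducible] def pointTopology {S : Type u} (V : Ultrafilter S) (s : S) : TopologicalSpace S where
  IsOpen O := s ∈ O → O ∈ V
  isOpen_univ _ := Filter.univ_mem
  isOpen_inter O O' h h' hs := Filter.inter_mem (h hs.1) (h' hs.2)
  isOpen_sUnion C h hs := by
    obtain ⟨O, hO, hs⟩ := hs
    exact mem_of_superset (h O hO hs) (Set.subset_sUnion_of_mem hO)

theorem le_nhds_pointTopology {S : Type u} (V : Ultrafilter S) (s : S) :
    (V : Filter S) ≤ @nhds S (pointTopology V s) s := by
  let _ := pointTopology V s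
  intro O hO
  obtain ⟨O', hO', h, hs⟩ := mem_nhds_iff.1 hO
  exact mem_of_superset (h hs) hO'

theorem psCont_pointTopology {S : Type u} [PsSpace S] {V : Ultrafilter S} {s : S} (h : Conv V s) :
    @PsCont (AsPs S) S (@AsPs.instPsSpace S (pointTopology V s)) _ (fun x => x) := by
  let t := pointTopology V s
  intro (U : Ultrafilter S) (x : S) hU
  change (U : Filter S) ≤ 𝓝 x at hU
  change Conv (U.map fun x => x) x
  rw [Ultrafilter.map_id']
  by_cases hx : x = s
  · subst hx
    have : (U : Filter S) ≤ (V : Filter S) ⊔ ((pure x : Ultrafilter S) : Filter S) := by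
      rintro O ⟨h1, h2⟩
      exact hU (IsOpen.mem_nhds (s := O) (fun _ => h1) h2)
    rcases Ultrafilter.le_sup_iff.1 this with h' | h'
    · rwa [Ultrafilter.coe_le_coe.1 h']
    · rw [Ultrafilter.coe_le_coe.1 h']; exact pure_conv x
  · have : (U : Filter S) ≤ ((pure x : Ultrafilter S) : Filter S) := by
      intro O hO
      have ho : IsOpen ({x} : Set S) := fun hs => absurd hs.symm hx
      refine mem_of_superset (hU (ho.mem_nhds rfl)) ?_
      rintro _ rfl
      exact hO
    rw [Ultrafilter.coe_le_coe.1 this]; exact pure_conv x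

namespace EpiRefl

theorem psCont_left {A B Y Z : Type u} [PsSpace A] [PsSpace B] [TopologicalSpace Y]
    [TopologicalSpace Z] {h : EpiRefl A × B → PsMap (AsPs Y) (AsPs Z)}
    (hh : PsCont (fun p : A × B => h (of p.1, p.2))) : PsCont h := by
  rintro W ⟨a, b⟩ ⟨hW1, hW2⟩
  rw [PsMap.conv_iff]
  intro T y hT hy
  obtain ⟨T', h1, h2, h3⟩ := ultra_exists_amalg h Prod.fst W T hT.symm
  let r : (EpiRefl A × B) × (PsMap (AsPs Y) (AsPs Z) × AsPs Y) → B × AsPs Y :=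
    fun q => (q.1.2, q.2.2)
  have hV : Conv (T'.map r) (b, y) := by
    refine ⟨?_, ?_⟩
    · rw [Ultrafilter.map_map]
      rw [← h1, Ultrafilter.map_map] at hW2
      exact hW2
    · rw [Ultrafilter.map_map]
      rw [← h2, Ultrafilter.map_map] at hy
      exact hy
  let t : TopologicalSpace (B × AsPs Y) := pointTopology (T'.map r) (b, y)
  let c : AsPs (B × AsPs Y) → B × AsPs Y := fun s => s
  have hc : PsCont c := psCont_pointTopology hV
  have hu : PsCont (fun q : A × AsPs (B × AsPs Y) => h (of q.1, (c q.2).1) (c q.2).2) := by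
    have e1 : PsCont (fun q : A × AsPs (B × AsPs Y) => c q.2) := hc.comp PsCont.snd
    have e2 : PsCont (fun q : A × AsPs (B × AsPs Y) => (q.1, (c q.2).1)) :=
      PsCont.prodMk PsCont.fst (PsCont.fst.comp e1)
    have e3 : PsCont (fun q : A × AsPs (B × AsPs Y) => h (of q.1, (c q.2).1)) :=
      PsCont.comp (g := fun p : A × B => h (of p.1, p.2)) 
        (f := fun q : A × AsPs (B × AsPs Y) => (q.1, (c q.2).1)) hh e2
    have e4 : PsCont (fun q : A × AsPs (B × AsPs Y) => (c q.2).2) := PsCont.snd.comp e1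
    exact PsCont.comp (g := fun p : PsMap (AsPs Y) (AsPs Z) × AsPs Y => p.1 p.2)
      (f := fun q : A × AsPs (B × AsPs Y) => (h (of q.1, (c q.2).1), (c q.2).2))
      PsMap.psCont_eval (PsCont.prodMk e3 e4)
  let k : A → PsMap (AsPs (B × AsPs Y)) (AsPs Z) := fun a =>
    ⟨fun s => h (of a, (c s).1) (c s).2,
      PsCont.comp (g := fun q : A × AsPs (B × AsPs Y) => h (of q.1, (c q.2).1) (c q.2).2)
        (f := fun s => (a, s)) hu (PsCont.prodMk (PsCont.const a) PsCont.id)⟩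
  have hk : PsCont k :=
    PsMap.psCont_curry (h := fun a s => h (of a, (c s).1) (c s).2) hu k (fun _ _ => rfl)
  have hka := hW1 _ _ k hk
  let r' : (EpiRefl A × B) × (PsMap (AsPs Y) (AsPs Z) × AsPs Y) →
    PsMap (AsPs (B × AsPs Y)) (AsPs Z) × AsPs (B × AsPs Y) := fun q => (k q.1.1, r q)
  have hfin := PsMap.conv_iff.1 hka (T'.map r') (b, y)
    (by
      rw [← h1]
      rfl)
    (by
      rw [Ultrafilter.map_map]
      exact le_nhds_pointTopology (T'.map r) (b, y))
  rw [Ultrafilter.map_map] at hfin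
  rw [← h2, Ultrafilter.map_map]
  have he : T'.map ((fun p : PsMap (AsPs Y) (AsPs Z) × AsPs Y => p.1 p.2) ∘ Prod.snd) =
      T'.map ((fun p : PsMap (AsPs (B × AsPs Y)) (AsPs Z) × AsPs (B × AsPs Y) => p.1 p.2) ∘ r') := by
    refine ultra_map_congr (h3.mono ?_)
    rintro ⟨⟨a', b'⟩, f', y'⟩ h'
    simp only at h'
    subst h'
    rfl
  rw [he]
  exact hfin

theorem psCont_right {A B Y Z : Type u} [PsSpace A] [PsSpace B] [TopologicalSpace Y]
    [TopologicalSpace Z] {h : A × EpiRefl B → PsMap (AsPs Y) (AsPs Z)}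
    (hh : PsCont (fun p : A × B => h (p.1, of p.2))) : PsCont h := by
  have : PsCont (fun q : EpiRefl B × A => h (q.2, q.1)) :=
    psCont_left (PsCont.comp (g := fun p : A × B => h (p.1, of p.2))
      (f := fun q : B × A => (q.2, q.1)) hh (PsCont.prodMk PsCont.snd PsCont.fst))
  exact PsCont.comp (g := fun q : EpiRefl B × A => h (q.2, q.1))
    (f := fun p : A × EpiRefl B => (p.2, p.1)) this (PsCont.prodMk PsCont.snd PsCont.fst)

/-- The reflection `R₁` preserves the continuity of maps of two variables. -/
theorem psCont_two {A B E : Type u} [PsSpace A] [PsSpace B] [PsSpace E] (hE : IsEpi E)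
    {m : EpiRefl A × EpiRefl B → E} (hm : PsCont (fun p : A × B => m (of p.1, of p.2))) :
    PsCont m := by
  obtain ⟨J, Y, Z, _, _, g, hg⟩ := hE
  intro U x h
  rw [hg]
  intro j
  have hgj : PsCont (g j) := fun V y hV => (hg V y).1 hV j
  have h1 : PsCont (fun p : EpiRefl A × EpiRefl B => g j (m p)) :=
    psCont_left (psCont_right (hgj.comp hm))
  rw [Ultrafilter.map_map]
  exact h1 U x h

end EpiRefl

/-! ### The reflection in topological spaces -/

/-- The underlying set of the topological reflection `R X`. -/
def TopRefl (X : Type u) : Type u := X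

/-- The topology of `R X`: a set `S` is open iff `S ∈ U` whenever `U → x ∈ S`. -/
instance (X : Type u) [PsSpace X] : TopologicalSpace (TopRefl X) where
  IsOpen S := ∀ (U : Ultrafilter X) (x : X), Conv U x → x ∈ (S : Set X) → (S : Set X) ∈ U
  isOpen_univ _ _ _ _ := Filter.univ_mem
  isOpen_inter _ _ h h' U x hU hx := Filter.inter_mem (h U x hU hx.1) (h' U x hU hx.2)
  isOpen_sUnion C h U x hU hx := by
    obtain ⟨O, hO, hx⟩ := hx
    exact mem_of_superset (h O hO U x hU hx) (Set.subset_sUnion_of_mem hO)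

instance (X : Type u) [h : Group X] : Group (TopRefl X) := h

instance (X : Type u) [h : Group X] : Group (EpiRefl X) := h

/-- A homomorphism, on the reflections. -/
def TopRefl.hom {X : Type u} {Y : Type v} [Group X] [Group Y] (f : X →* Y) :
    TopRefl X →* TopRefl Y := f

/-- A homomorphism, on the reflections. -/
def EpiRefl.hom {X : Type u} {Y : Type v} [Group X] [Group Y] (f : X →* Y) :
    EpiRefl X →* EpiRefl Y := f

theorem EpiRefl.psCont_mul {X : Type u} [PsSpace X] [Group X]
    (h : PsCont (fun p : X × X => p.1 * p.2)) :
    PsCont (fun p : EpiRefl X × EpiRefl X => p.1 * p.2) :=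
  EpiRefl.psCont_two EpiRefl.isEpi (PsCont.comp (g := EpiRefl.of)
    (f := fun p : X × X => p.1 * p.2) EpiRefl.psCont_of h)

theorem EpiRefl.psCont_inv {X : Type u} [PsSpace X] [Group X] (h : PsCont (fun x : X => x⁻¹)) :
    PsCont (fun x : EpiRefl X => x⁻¹) :=
  (EpiRefl.psCont_iff EpiRefl.isEpi).2 (PsCont.comp (g := EpiRefl.of)
    (f := fun x : X => x⁻¹) EpiRefl.psCont_of h)

theorem EpiRefl.psCont_hom {X Y : Type u} [PsSpace X] [PsSpace Y] [Group X] [Group Y]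
    {f : X →* Y} (hf : PsCont f) : PsCont (EpiRefl.hom f) :=
  (EpiRefl.psCont_iff EpiRefl.isEpi).2 (PsCont.comp (g := EpiRefl.of) EpiRefl.psCont_of hf)

/-- The universal property of the reflection `R`. -/
theorem TopRefl.continuous_iff {X : Type u} {Y : Type v} [PsSpace X] [TopologicalSpace Y]
    {f : X → Y} : @Continuous (TopRefl X) Y _ _ f ↔ @PsCont X (AsPs Y) _ _ f := by
  refine ⟨fun hf U x h O hO => ?_, fun hf => continuous_def.2 fun S hS U x hU hx => ?_⟩
  · obtain ⟨O', hO', h1, h2⟩ := mem_nhds_iff.1 hO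
    exact mem_of_superset (continuous_def.1 hf O' h1 U x h h2) (Set.preimage_mono hO')
  · exact hf U x hU (hS.mem_nhds hx)

theorem TopRefl.continuous_map {X : Type u} {Y : Type v} [PsSpace X] [PsSpace Y] {f : X → Y}
    (hf : PsCont f) : @Continuous (TopRefl X) (TopRefl Y) _ _ f :=
  continuous_def.2 fun _ hS U x hU hx => hS (U.map f) (f x) (hf U x hU) hx

theorem TopRefl.continuous_hom {X : Type u} {Y : Type v} [PsSpace X] [PsSpace Y] [Group X]
    [Group Y] {f : X →* Y} (hf : PsCont f) : Continuous (TopRefl.hom f) :=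
  TopRefl.continuous_map (f := f) hf

/-! ### Pointed spaces -/

/-- Pointed topological spaces, the objects of the category `Top_*`. -/
structure TopPt : Type (u + 1) where
  carrier : Type u
  [top : TopologicalSpace carrier]
  pt : carrier

attribute [instance] TopPt.top

namespace TopPt

/-- Based continuous maps. -/
@[ext] structure Hom (X Y : TopPt.{u}) : Type u where
  toFun : X.carrier → Y.carrier
  cont : Continuous toFun
  map_pt : toFun X.pt = Y.pt

instance : Category TopPt.{u} where
  Hom := Hom
  id _ := ⟨fun x => x, continuous_id, rfl⟩
  comp f g := ⟨fun x => g.toFun (f.toFun x), g.cont.comp f.cont,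
    (congrArg g.toFun f.map_pt).trans g.map_pt⟩

end TopPt

/-- Pointed pseudospaces, the objects of the category `PsTop_*`. -/
structure PsTopPt : Type (u + 1) where
  carrier : Type u
  [ps : PsSpace carrier]
  pt : carrier

attribute [instance] PsTopPt.ps

namespace PsTopPt

/-- Based continuous maps. -/
@[ext] structure Hom (X Y : PsTopPt.{u}) : Type u where
  toFun : X.carrier → Y.carrier
  cont : PsCont toFun
  map_pt : toFun X.pt = Y.pt

instance : Category PsTopPt.{u} where
  Hom := Hom
  id _ := ⟨fun x => x, PsCont.id, rfl⟩
  comp f g := ⟨fun x => g.toFun (f.toFun x), g.cont.comp f.cont,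
    (congrArg g.toFun f.map_pt).trans g.map_pt⟩

end PsTopPt

/-- The category of pointed epispaces, a full subcategory of that of pointed pseudospaces. -/
abbrev EpiTopPt : Type (u + 1) :=
  ObjectProperty.FullSubcategory (fun X : PsTopPt.{u} => IsEpi X.carrier)

/-- The inclusion of pointed topological spaces in pointed pseudospaces. -/
def topToPs : TopPt.{u} ⥤ PsTopPt.{u} where
  obj X := ⟨AsPs X.carrier, AsPs.of X.pt⟩
  map {X Y} f :=
    { toFun := fun x : AsPs X.carrier => AsPs.of (f.toFun x)
      cont := psCont_asPs (X := X.carrier) (Y := Y.carrier) f.cont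
      map_pt := f.map_pt }

/-- The inclusion of pointed topological spaces in pointed epispaces. -/
def topToEpi : TopPt.{u} ⥤ EpiTopPt.{u} :=
  ObjectProperty.lift _ topToPs fun X => isEpi_asPs X.carrier

/-! ### Groups with a compatible structure -/

/-- Pseudotopological groups: groups with a pseudotopology making multiplication and inversion
continuous. -/
structure PsTopGrp : Type (u + 1) where
  carrier : Type u
  [group : Group carrier]
  [ps : PsSpace carrier]
  psCont_mul : PsCont (fun p : carrier × carrier => p.1 * p.2)
  psCont_inv : PsCont (fun x : carrier => x⁻¹)

attribute [instance] PsTopGrp.group PsTopGrp.ps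

namespace PsTopGrp

/-- Continuous homomorphisms. -/
@[ext] structure Hom (G H : PsTopGrp.{u}) : Type u where
  toMonoidHom : G.carrier →* H.carrier
  cont : PsCont toMonoidHom

instance : Category PsTopGrp.{u} where
  Hom := Hom
  id G := ⟨MonoidHom.id G.carrier, PsCont.id⟩
  comp f g := ⟨g.toMonoidHom.comp f.toMonoidHom, g.cont.comp f.cont⟩

end PsTopGrp

/-- The category of epitopological groups. As products of epispaces are the same in epispaces
and in pseudospaces, these are the pseudotopological groups that are epispaces. -/
abbrev EpiTopGrp : Type (u + 1) :=
  ObjectProperty.FullSubcategory (fun G : PsTopGrp.{u} => IsEpi G.carrier)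

/-- Quasitopological groups: groups with a topology such that the inversion and all
left and right translations are continuous. -/
structure QTopGrp : Type (u + 1) where
  carrier : Type u
  [group : Group carrier]
  [top : TopologicalSpace carrier]
  [sepMul : SeparatelyContinuousMul carrier]
  [contInv : ContinuousInv carrier]

attribute [instance] QTopGrp.group QTopGrp.top

namespace QTopGrp

/-- Continuous homomorphisms. -/
@[ext] structure Hom (G H : QTopGrp.{u}) : Type u where
  toMonoidHom : G.carrier →* H.carrier
  cont : Continuous toMonoidHom

instance : Category QTopGrp.{u} where
  Hom := Hom
  id G := ⟨MonoidHom.id G.carrier, continuous_id⟩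
  comp f g := ⟨g.toMonoidHom.comp f.toMonoidHom, g.cont.comp f.cont⟩

end QTopGrp

/-- The reflector `R`, from pseudotopological groups to quasitopological groups. -/
def reflR : PsTopGrp.{u} ⥤ QTopGrp.{u} where
  obj G :=
    { carrier := TopRefl G.carrier
      sepMul :=
        { continuous_const_mul := fun {a} =>
            TopRefl.continuous_map (f := fun x : G.carrier => (show G.carrier from a) * x)
              (PsCont.comp (g := fun p : G.carrier × G.carrier => p.1 * p.2)
                (f := fun x => (a, x)) G.psCont_mul (PsCont.prodMk (PsCont.const _) PsCont.id))
          continuous_mul_const := fun {a} =>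
            TopRefl.continuous_map (f := fun x : G.carrier => x * (show G.carrier from a))
              (PsCont.comp (g := fun p : G.carrier × G.carrier => p.1 * p.2)
                (f := fun x => (x, a)) G.psCont_mul
                (PsCont.prodMk PsCont.id (PsCont.const _))) }
      contInv := ⟨TopRefl.continuous_map (X := G.carrier) (Y := G.carrier)
        (f := fun x => x⁻¹) G.psCont_inv⟩ }
  map {G H} f := ⟨TopRefl.hom f.toMonoidHom,
    TopRefl.continuous_hom (X := G.carrier) (Y := H.carrier) f.cont⟩

/-- The reflector `R₂`, from epitopological groups to quasitopological groups: the restriction of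
`R`. -/
def reflR₂ : EpiTopGrp.{u} ⥤ QTopGrp.{u} := ObjectProperty.ι _ ⋙ reflR

/-! ### The fundamental group functors -/

/-- The pseudotopological fundamental group functor: path components of the loop pseudospace, with
the quotient pseudotopology. -/
noncomputable def piPs : PsTopPt.{u} ⥤ PsTopGrp.{u} where
  obj X := ⟨PsPi1 X.carrier X.pt, PsPi1.psCont_mul, PsPi1.psCont_inv⟩
  map f := ⟨PsPi1.map f.toFun f.cont f.map_pt, PsPi1.psCont_map _ _ _⟩
  map_id X := by
    refine PsTopGrp.Hom.ext (MonoidHom.ext fun a => ?_)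
    obtain ⟨a, rfl⟩ := PathComp.mk_surjective a
    rfl
  map_comp f g := by
    refine PsTopGrp.Hom.ext (MonoidHom.ext fun a => ?_)
    obtain ⟨a, rfl⟩ := PathComp.mk_surjective a
    rfl

/-- The epitopological fundamental group functor: path components of the loop epispace, with the
quotient epitopology. The loop epispace is the loop pseudospace, as function spaces and subspaces
of epispaces are the same in epispaces and in pseudospaces; the quotient (final) structure in
epispaces is the reflection `R₁` of that in pseudospaces. -/
noncomputable def piEpi : EpiTopPt.{u} ⥤ EpiTopGrp.{u} where
  obj X :=
    ⟨⟨EpiRefl (PsPi1 X.obj.carrier X.obj.pt),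
      EpiRefl.psCont_mul (X := PsPi1 X.obj.carrier X.obj.pt) PsPi1.psCont_mul,
      EpiRefl.psCont_inv (X := PsPi1 X.obj.carrier X.obj.pt) PsPi1.psCont_inv⟩,
      EpiRefl.isEpi (X := PsPi1 X.obj.carrier X.obj.pt)⟩
  map {X Y} f := ObjectProperty.homMk ⟨EpiRefl.hom (PsPi1.map f.hom.toFun f.hom.cont f.hom.map_pt),
    EpiRefl.psCont_hom (X := PsPi1 X.obj.carrier X.obj.pt)
      (Y := PsPi1 Y.obj.carrier Y.obj.pt) (PsPi1.psCont_map _ _ _)⟩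
  map_id X := by
    refine ObjectProperty.hom_ext _ (PsTopGrp.Hom.ext (MonoidHom.ext fun a => ?_))
    obtain ⟨a, rfl⟩ := PathComp.mk_surjective a
    rfl
  map_comp f g := by
    refine ObjectProperty.hom_ext _ (PsTopGrp.Hom.ext (MonoidHom.ext fun a => ?_))
    obtain ⟨a, rfl⟩ := PathComp.mk_surjective a
    rfl

/-- The underlying set of Biss's topologized fundamental group: the path components of the loop
space (with the compact-open topology), with the quotient topology. -/
abbrev BissPi1 (X : Type u) [TopologicalSpace X] (x₀ : X) : Type u := ZerothHomotopy (Path x₀ x₀)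

namespace BissPi1

variable {X : Type u} [TopologicalSpace X] {x₀ : X}

theorem sound_homotopy {p q : Path x₀ x₀} (F : p.Homotopy q) :
    ZerothHomotopy.mk p = ZerothHomotopy.mk q := by
  refine ZerothHomotopy.sound ⟨⟨F.eval, ?_⟩, F.eval_zero, F.eval_one⟩
  exact Path.continuous_uncurry_iff.1 F.continuous

theorem joined_prod {A : Type u} {B : Type v} [TopologicalSpace A] [TopologicalSpace B]
    {a a' : A} {b b' : B} (h : Joined a a') (h' : Joined b b') : Joined (a, b) (a', b') := by
  obtain ⟨γ⟩ := h
  obtain ⟨δ⟩ := h'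
  exact ⟨γ.prod δ⟩

noncomputable instance : Mul (BissPi1 X x₀) :=
  ⟨Quotient.lift₂ (fun p q => ZerothHomotopy.mk (p.trans q)) fun _ _ _ _ h h' => by
    obtain ⟨γ⟩ := joined_prod h h'
    exact Quotient.sound ⟨γ.map Path.continuous_trans⟩⟩

noncomputable instance : One (BissPi1 X x₀) := ⟨ZerothHomotopy.mk (Path.refl x₀)⟩

noncomputable instance : Inv (BissPi1 X x₀) :=
  ⟨Quotient.lift (fun p => ZerothHomotopy.mk p.symm) fun _ _ h => by
    obtain ⟨γ⟩ := h
    exact Quotient.sound ⟨γ.map Path.continuous_symm⟩⟩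

/-- The group structure induced by concatenation of loops. -/
noncomputable instance : Group (BissPi1 X x₀) :=
  Group.ofLeftAxioms
    (by
      rintro ⟨a⟩ ⟨b⟩ ⟨c⟩
      exact sound_homotopy (Path.Homotopy.transAssoc a b c))
    (by
      rintro ⟨a⟩
      exact sound_homotopy (Path.Homotopy.reflTrans a))
    (by
      rintro ⟨a⟩
      exact (sound_homotopy (Path.Homotopy.reflSymmTrans a)).symm)

instance : SeparatelyContinuousMul (BissPi1 X x₀) where
  continuous_const_mul {a} := by
    obtain ⟨a⟩ := a
    refine ZerothHomotopy.isQuotientMap_mk.continuous_iff.2 ?_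
    exact continuous_quotient_mk'.comp
      (Path.continuous_trans.comp (continuous_const.prodMk continuous_id))
  continuous_mul_const {a} := by
    obtain ⟨a⟩ := a
    refine ZerothHomotopy.isQuotientMap_mk.continuous_iff.2 ?_
    exact continuous_quotient_mk'.comp
      (Path.continuous_trans.comp (continuous_id.prodMk continuous_const))

instance : ContinuousInv (BissPi1 X x₀) where
  continuous_inv := by
    refine ZerothHomotopy.isQuotientMap_mk.continuous_iff.2 ?_
    exact continuous_quotient_mk'.comp Path.continuous_symm

variable {Y : Type v} [TopologicalSpace Y] {y₀ : Y}

/-- The map of loop spaces induced by a based continuous map. -/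
def loopMap (f : X → Y) (hf : Continuous f) (h : f x₀ = y₀) (p : Path x₀ x₀) : Path y₀ y₀ :=
  (p.map hf).cast h.symm h.symm

theorem continuous_loopMap (f : X → Y) (hf : Continuous f) (h : f x₀ = y₀) :
    Continuous (loopMap f hf h) := by
  subst h
  exact Path.continuous_uncurry_iff.1 (hf.comp continuous_eval)

/-- The homomorphism `[l] ↦ [f ∘ l]` induced by a based continuous map. -/
noncomputable def map (f : X → Y) (hf : Continuous f) (h : f x₀ = y₀) :
    BissPi1 X x₀ →* BissPi1 Y y₀ :=
  MonoidHom.mk' (Quotient.lift (fun p => ZerothHomotopy.mk (loopMap f hf h p)) fun _ _ h' => by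
    obtain ⟨γ⟩ := h'
    exact Quotient.sound ⟨γ.map (continuous_loopMap f hf h)⟩) (by
    rintro ⟨a⟩ ⟨b⟩
    refine congrArg ZerothHomotopy.mk ?_
    subst h
    exact Path.map_trans a b hf)

theorem continuous_map (f : X → Y) (hf : Continuous f) (h : f x₀ = y₀) :
    Continuous (map f hf h) := by
  refine ZerothHomotopy.isQuotientMap_mk.continuous_iff.2 ?_
  exact continuous_quotient_mk'.comp (continuous_loopMap f hf h)

end BissPi1

/-- Biss's topologized fundamental group functor. -/
noncomputable def biss : TopPt.{u} ⥤ QTopGrp.{u} where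
  obj X := { carrier := BissPi1 X.carrier X.pt }
  map f := ⟨BissPi1.map f.toFun f.cont f.map_pt, BissPi1.continuous_map _ _ _⟩
  map_id X := by
    refine QTopGrp.Hom.ext (MonoidHom.ext ?_)
    rintro ⟨a⟩
    rfl
  map_comp f g := by
    refine QTopGrp.Hom.ext (MonoidHom.ext ?_)
    rintro ⟨a⟩
    rfl

/-- A loop in a topological space `X`, as a loop in the pseudospace `X`. -/
def PsLoop.ofPath {X : Type u} [TopologicalSpace X] {x₀ : X} (l : Path x₀ x₀) :
    PsLoop (AsPs X) (AsPs.of x₀) :=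
  ⟨⟨fun t => AsPs.of (l t), psCont_ofTop (Y := X) l.continuous⟩, l.source, l.target⟩

/-- The class of a loop in `R₂ (π₁ᵉᵖⁱ X)`. -/
noncomputable def epiClass (X : TopPt.{u}) (l : Path X.pt X.pt) :
    ((topToEpi ⋙ piEpi ⋙ reflR₂).obj X).carrier :=
  PathComp.mk (PsLoop.ofPath (X := X.carrier) (x₀ := X.pt) l)

/-- The class of a loop in `R (π₁ᵖˢ X)`. -/
noncomputable def psClass (X : TopPt.{u}) (l : Path X.pt X.pt) :
    ((topToPs ⋙ piPs ⋙ reflR).obj X).carrier :=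
  PathComp.mk (PsLoop.ofPath (X := X.carrier) (x₀ := X.pt) l)

/-- The class of a loop in Biss's group. -/
noncomputable def bissClass (X : TopPt.{u}) (l : Path X.pt X.pt) : (biss.obj X).carrier :=
  ZerothHomotopy.mk l

/-!
The unit interval is compact, so a filter of paths converges in the compact-open topology if and
only if it converges continuously, that is, in the exponential pseudotopology `X ^ [0, 1]`
(`ContinuousMap.le_nhds_iff_tendsto_eval`). Hence for a topological space `X` the tautological
bijection from the space of loops with the compact-open topology to the loop pseudospace is an
isomorphism of pseudospaces (`PsLoop.conv_ofPath_iff`). It therefore matches path components with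
path components, which gives an isomorphism of the underlying groups (`psPi1EquivBiss`).

A subset of the quotient pseudospace is open in its topological reflection iff its preimage in the
loop pseudospace is stable under convergence (`PathComp.isOpen_topRefl_iff`), i.e. iff the preimage
is open in the compact-open topology, which is the definition of the quotient topology. This
settles the pseudotopological group. As topological spaces are epispaces, the topological
reflection of a pseudospace factors through its epitopological reflection
(`TopRefl.isOpen_epiRefl_iff`), and the epitopological case follows.
-/

/-! ### Ultrafilter convergence in topological spaces -/

theorem fConv_ofTop_iff {X : Type u} [TopologicalSpace X] {F : Filter X} {x : X} :
    @FConv X (PsSpace.ofTop X) F x ↔ F ≤ 𝓝 x :=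
  Filter.le_iff_ultrafilter.symm

theorem psCont_ofTop_iff {X : Type u} {Y : Type v} [TopologicalSpace X] [TopologicalSpace Y]
    {f : X → Y} : @PsCont X Y (PsSpace.ofTop X) (PsSpace.ofTop Y) f ↔ Continuous f :=
  ⟨fun h => continuous_iff_ultrafilter.2 fun x U hU => h U x hU, psCont_ofTop⟩

/-- On a locally compact space, convergence in the compact-open topology is continuous
convergence. -/
theorem ContinuousMap.le_nhds_iff_tendsto_eval {A : Type u} {B : Type v} [TopologicalSpace A]
    [TopologicalSpace B] [LocallyCompactSpace A] {L : Filter C(A, B)} {f : C(A, B)} :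
    L ≤ 𝓝 f ↔ ∀ x, Tendsto (fun p : C(A, B) × A => p.1 p.2) (L ×ˢ 𝓝 x) (𝓝 (f x)) := by
  constructor
  · intro h x
    have hc : Tendsto (fun p : C(A, B) × A => p.1 p.2) (𝓝 (f, x)) (𝓝 (f x)) :=
      (continuous_eval (F := C(A, B))).tendsto (f, x)
    rw [nhds_prod_eq] at hc
    exact hc.mono_left (Filter.prod_mono_left _ h)
  · intro h
    -- Compactness of `K` turns the pointwise hypotheses into one for neighbourhoods of `K`.
    refine ContinuousMap.tendsto_nhds_compactOpen.2 fun K hK U hU hf => ?_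
    have hev : ∀ᶠ p in L ×ˢ 𝓝ˢ K, p.1 p.2 ∈ U := by
      rw [hK.prod_nhdsSet_eq_biSup]
      simp only [Filter.eventually_iSup]
      exact fun x hx => h x (hU.mem_nhds (hf hx))
    filter_upwards [hev.curry] with g hg x hx
    exact hg.self_of_nhdsSet x hx

/-! ### The loop space of a topological space -/

namespace PsLoop

variable {X : Type u} [TopologicalSpace X] {x₀ : X}

/-- The loops of a topological space are the loops of the associated pseudospace. -/
def pathEquiv (x₀ : X) : Path x₀ x₀ ≃ PsLoop (AsPs X) (AsPs.of x₀) where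
  toFun := ofPath
  invFun l :=
    { toFun := fun t => (l.val t : AsPs X)
      continuous_toFun := psCont_ofTop_iff.1 l.val.cont
      source' := l.source
      target' := l.target }
  left_inv _ := rfl
  right_inv _ := rfl

/-- The pseudotopology of the loop pseudospace is the compact-open topology. -/
theorem conv_ofPath_iff {U : Ultrafilter (Path x₀ x₀)} {l : Path x₀ x₀} :
    Conv (U.map ofPath) (ofPath l) ↔ (U : Filter (Path x₀ x₀)) ≤ 𝓝 l := by
  -- Evaluation does not see whether a path is regarded as a loop of the pseudospace.
  have hev (G : Filter I) :
      Filter.map (fun p : PsMap I (AsPs X) × I => p.1 p.2)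
          ((((U.map ofPath).map val : Ultrafilter (PsMap I (AsPs X))) :
            Filter (PsMap I (AsPs X))) ×ˢ G) =
        Filter.map (fun p : C(I, X) × I => p.1 p.2)
          (Filter.map (fun p : Path x₀ x₀ => p.toContinuousMap)
            (U : Filter (Path x₀ x₀)) ×ˢ G) := by
    rw [Ultrafilter.map_map, Ultrafilter.coe_map, ← Filter.map_id (f := G), Filter.prod_map_map_eq,
      Filter.prod_map_map_eq, Filter.map_map, Filter.map_map]
    rfl
  have hnhds : (U : Filter (Path x₀ x₀)) ≤ 𝓝 l ↔
      Filter.map (fun p : Path x₀ x₀ => p.toContinuousMap) (U : Filter (Path x₀ x₀)) ≤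
        𝓝 l.toContinuousMap := by
    rw [Filter.map_le_iff_le_comap, ← nhds_induced]
  rw [hnhds, ContinuousMap.le_nhds_iff_tendsto_eval]
  constructor
  · intro h x
    have hx := (fConv_ofTop_iff (X := X)).1 (h (𝓝 x) x ((fConv_ofTop_iff (X := I)).2 le_rfl))
    rw [hev] at hx
    exact hx
  · intro h G x hG
    have hx := (h x).mono_left (Filter.prod_mono_right _ ((fConv_ofTop_iff (X := I)).1 hG))
    refine (fConv_ofTop_iff (X := X)).2 ?_
    rw [hev]
    exact hx

theorem conv_iff_symm {U : Ultrafilter (PsLoop (AsPs X) (AsPs.of x₀))}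
    {l : PsLoop (AsPs X) (AsPs.of x₀)} :
    Conv U l ↔ (U.map (pathEquiv x₀).symm : Filter (Path x₀ x₀)) ≤ 𝓝 ((pathEquiv x₀).symm l) := by
  rw [← conv_ofPath_iff, Ultrafilter.map_map]
  change _ ↔ Conv (U.map id) l
  rw [Ultrafilter.map_id]

theorem psJoined_ofPath_iff {p q : Path x₀ x₀} : PsJoined (ofPath p) (ofPath q) ↔ Joined p q := by
  constructor
  · rintro ⟨γ, h0, h1⟩
    refine ⟨⟨⟨fun t => (pathEquiv x₀).symm (γ t), ?_⟩, ?_, ?_⟩⟩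
    · refine psCont_ofTop_iff.1 fun U t hU => ?_
      have := conv_iff_symm.1 (γ.cont U t hU)
      rwa [Ultrafilter.map_map] at this
    · exact congrArg (pathEquiv x₀).symm h0
    · exact congrArg (pathEquiv x₀).symm h1
  · rintro ⟨γ⟩
    refine ⟨⟨fun t => ofPath (γ t), fun U t hU => ?_⟩, congrArg ofPath γ.source,
      congrArg ofPath γ.target⟩
    have := conv_ofPath_iff.2 (psCont_ofTop γ.continuous U t hU)
    rwa [Ultrafilter.map_map] at this

theorem ofPath_trans (p q : Path x₀ x₀) : ofPath (p.trans q) = (ofPath p).mul (ofPath q) :=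
  ext fun _ => rfl

end PsLoop

/-! ### Open sets of the reflections -/

theorem PathComp.isOpen_topRefl_iff {X : Type u} [PsSpace X] {S : Set (PathComp X)} :
    @IsOpen (TopRefl (PathComp X)) _ S ↔ @IsOpen (TopRefl X) _ (PathComp.mk (X := X) ⁻¹' S) := by
  constructor
  · intro h U x hU hx
    exact h _ _ (PathComp.psCont_mk U x hU) hx
  · rintro h _ _ ⟨U, x, hU, rfl, rfl⟩ hx
    exact h U x hU hx

/-- The topological reflection factors through the epitopological one. -/
theorem TopRefl.isOpen_epiRefl_iff {X : Type u} [PsSpace X] {S : Set X} :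
    @IsOpen (TopRefl (EpiRefl X)) _ S ↔ @IsOpen (TopRefl X) _ S := by
  have h₁ : @Continuous (TopRefl X) (TopRefl (EpiRefl X)) _ _ (fun x => x) :=
    TopRefl.continuous_map (X := X) (Y := EpiRefl X) EpiRefl.psCont_of
  have h₂ : @Continuous (TopRefl (EpiRefl X)) (TopRefl X) _ _ (fun x => x) :=
    (TopRefl.continuous_iff (X := EpiRefl X)).2
      ((EpiRefl.psCont_iff (X := X) (isEpi_asPs (TopRefl X))).2
        ((TopRefl.continuous_iff (X := X) (Y := TopRefl X)).1 continuous_id))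
  exact ⟨fun h => continuous_def.1 h₁ S h, fun h => continuous_def.1 h₂ S h⟩

theorem PsLoop.isOpen_topRefl_iff {X : Type u} [TopologicalSpace X] {x₀ : X}
    {S : Set (PsLoop (AsPs X) (AsPs.of x₀))} :
    @IsOpen (TopRefl (PsLoop (AsPs X) (AsPs.of x₀))) _ S ↔
      IsOpen (PsLoop.ofPath ⁻¹' S : Set (Path x₀ x₀)) := by
  constructor
  · intro h
    refine isOpen_iff_ultrafilter.2 fun l hl U hU => ?_
    exact h _ _ (PsLoop.conv_ofPath_iff.2 hU) hl
  · intro h U l hU hl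
    exact (PsLoop.conv_iff_symm.1 hU) (h.mem_nhds (x := (PsLoop.pathEquiv x₀).symm l) hl)

/-! ### Comparison of the fundamental groups -/

/-- The group isomorphism from the path components of the loop pseudospace of a topological space
to those of its loop space, sending the class of each loop to the class of the same loop. -/
noncomputable def psPi1EquivBiss {X : Type u} [TopologicalSpace X] (x₀ : X) :
    PsPi1 (AsPs X) (AsPs.of x₀) ≃* BissPi1 X x₀ :=
  MulEquiv.symm
    { toFun := Quotient.map PsLoop.ofPath fun _ _ h => PsLoop.psJoined_ofPath_iff.2 h
      invFun := Quotient.map (PsLoop.pathEquiv x₀).symm fun _ _ h =>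
        PsLoop.psJoined_ofPath_iff.1 h
      left_inv := by rintro ⟨p⟩; rfl
      right_inv := by rintro ⟨l⟩; rfl
      map_mul' := by
        rintro ⟨p⟩ ⟨q⟩
        exact congrArg PathComp.mk (PsLoop.ofPath_trans p q) }

/-- Openness on either side is openness of the preimage in the loop space with the compact-open
topology. -/
theorem isOpen_preimage_psPi1EquivBiss {X : Type u} [TopologicalSpace X] {x₀ : X}
    {S : Set (BissPi1 X x₀)} :
    @IsOpen (TopRefl (PsPi1 (AsPs X) (AsPs.of x₀))) _ (psPi1EquivBiss x₀ ⁻¹' S) ↔ IsOpen S :=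
  PathComp.isOpen_topRefl_iff.trans (PsLoop.isOpen_topRefl_iff.trans
    ZerothHomotopy.isQuotientMap_mk.isOpen_preimage)

/-- A group isomorphism under which the open sets correspond is an isomorphism of quasitopological
groups. -/
def QTopGrp.isoMk {G H : QTopGrp.{u}} (e : G.carrier ≃* H.carrier)
    (he : ∀ S : Set H.carrier, IsOpen (e ⁻¹' S) ↔ IsOpen S) : G ≅ H where
  hom := ⟨e.toMonoidHom, continuous_def.2 fun S hS => (he S).2 hS⟩
  inv := ⟨e.symm.toMonoidHom, continuous_def.2 fun S hS => (he _).1 (by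
    change IsOpen (e ⁻¹' (e.symm ⁻¹' S))
    rwa [← Set.preimage_comp, e.symm_comp_self, Set.preimage_id])⟩
  hom_inv_id := QTopGrp.Hom.ext (MonoidHom.ext e.symm_apply_apply)
  inv_hom_id := QTopGrp.Hom.ext (MonoidHom.ext e.apply_symm_apply)

/-- The natural isomorphism for the pseudotopological fundamental group, with components
`psPi1EquivBiss`. -/
noncomputable def reflRPiPsIsoBiss : topToPs.{u} ⋙ piPs.{u} ⋙ reflR.{u} ≅ biss.{u} :=
  NatIso.ofComponents
    (fun X => QTopGrp.isoMk (G := (topToPs ⋙ piPs ⋙ reflR).obj X) (H := biss.obj X)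
      (psPi1EquivBiss X.pt) fun _ => isOpen_preimage_psPi1EquivBiss)
    (fun f => QTopGrp.Hom.ext (MonoidHom.ext (by rintro ⟨l⟩; rfl)))

/-- The natural isomorphism for the epitopological fundamental group. Its components are again
`psPi1EquivBiss`, as the epitopological reflection keeps the underlying group. -/
noncomputable def reflR₂PiEpiIsoBiss : topToEpi.{u} ⋙ piEpi.{u} ⋙ reflR₂.{u} ≅ biss.{u} :=
  NatIso.ofComponents
    (fun X => QTopGrp.isoMk (G := (topToEpi ⋙ piEpi ⋙ reflR₂).obj X) (H := biss.obj X)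
      (psPi1EquivBiss X.pt) fun _ =>
        (TopRefl.isOpen_epiRefl_iff (X := PsPi1 (AsPs X.carrier) (AsPs.of X.pt))).trans
          isOpen_preimage_psPi1EquivBiss)
    (fun f => QTopGrp.Hom.ext (MonoidHom.ext (by rintro ⟨l⟩; rfl)))

theorem mainTheorem4 :
    (∃ e : topToEpi.{u} ⋙ piEpi.{u} ⋙ reflR₂.{u} ≅ biss.{u},
      ∀ (X : TopPt.{u}) (l : Path X.pt X.pt),
        (e.hom.app X).toMonoidHom (epiClass X l) = bissClass X l) ∧
    (∃ e : topToPs.{u} ⋙ piPs.{u} ⋙ reflR.{u} ≅ biss.{u},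
      ∀ (X : TopPt.{u}) (l : Path X.pt X.pt),
        (e.hom.app X).toMonoidHom (psClass X l) = bissClass X l) :=
  ⟨⟨reflR₂PiEpiIsoBiss, fun _ _ => rfl⟩, ⟨reflRPiPsIsoBiss, fun _ _ => rfl⟩⟩
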